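/- Let $\Gamma$ be a vector space over a field $K$ in which $6\neq 0$, with a bilinear bracket $[\cdot,\cdot]:\Gamma\times\Gamma\to\Gamma$. Define the Yamaguti brackets and the Yamagutian $\hat Y(x;y)\in\operatorname{End}_K(\Gamma)$ by $$[x,y,z]=[x,[y,z]]-[y,[x,z]]+[[x,y],z],\qquad 6\,\hat Y(x;y)z=[x,y,z].$$ **Theorem (hidden associativity).** For all $x,y,z,w\in\Gamma$ the commutation relation $$6\,[\hat Y(x;y),\hat Y(z;w)]=\hat Y([x,y,z];w)+\hat Y(z;[x,y,w])\qquad(1)$$ (where the bracket on the left is the commutator of linear operators) holds if and only if, for all $v\in\Gamma$, $$[x,y,[z,w,v]]=[[x,y,z],w,v]+[z,[x,y,w],v]+[z,w,[x,y,v]].\qquad(2)$$ In particular, (1) holds identically on $\Gamma$ if and only if (2) does. Identity (2) is the last of the defining identities (a)–(f) of a general Lie triple system, - (a) $[x,y]=-[y,x]$, - (b) $[x,y,z]=-[y,x,z]$, - (c) $[x,y,z]+[y,z,x]+[z,x,y]+[[x,y],z]+[[y,z],x]+[[z,x],y]=0$, - (d) $[[x,y],z,u]+[[y,z],x,u]+[[z,x],y,u]=0$,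 - (e) $[x,y,[z,u]]=[[x,y,z],u]+[z,[x,y,u]]$, - (f) the identity (2), so that $\Gamma$ with its bracket and its Yamaguti brackets is a general Lie triple system if and only if (a)–(e) and (1) hold identically. In particular, the equivalence of (1) and (2) holds for the tangent algebra $\Gamma=T_e(G)$ of every local real analytic Moufang loop $G$ of finite dimension. In coordinates centred at the unit, $G$ is given by germs at $0$ of an analytic multiplication with unit $0$ and analytic left and right divisions, satisfying the Moufang identity $(xy)(zx)=(x(yz))x$; if $B$ is the bilinear part of the multiplication, $xy=x+y+B(x,y)+\cdots$, then the bracket of the tangent algebra is $[x,y]=B(x,y)-B(y,x)$. -/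

import Mathlib

open Filter Topology

noncomputable section

/-! ### Yamaguti brackets and the Yamagutian of an algebra with a bilinear bracket -/

section Algebra

variable {K Γ : Type*} [Field K] [AddCommGroup Γ] [Module K Γ]

/-- The ternary Yamaguti bracket `[x,y,z] = [x,[y,z]] - [y,[x,z]] + [[x,y],z]`. -/
def yamagutiBracket (br : Γ →ₗ[K] Γ →ₗ[K] Γ) (x y z : Γ) : Γ :=
  br x (br y z) - br y (br x z) + br (br x y) z

/-- The Yamagutian `Ŷ(x;y)`, the linear operator on `Γ` with `6 Ŷ(x;y) z = [x,y,z]`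
(meaningful when `6` is invertible in `K`). -/
def yamagutian (br : Γ →ₗ[K] Γ →ₗ[K] Γ) (x y : Γ) : Module.End K Γ where
  toFun z := (6 : K)⁻¹ • yamagutiBracket br x y z
  map_add' z w := by
    simp only [yamagutiBracket, map_add, ← smul_add]
    congr 1
    abel
  map_smul' c z := by
    simp only [yamagutiBracket, map_smul, RingHom.id_apply]
    rw [← smul_sub, ← smul_add, smul_comm]

/-- The defining property of the Yamagutian. -/
theorem six_smul_yamagutian (h6 : (6 : K) ≠ 0) (br : Γ →ₗ[K] Γ →ₗ[K] Γ) (x y z : Γ) :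
    (6 : K) • yamagutian br x y z = yamagutiBracket br x y z :=
  smul_inv_smul₀ h6 _

/-- The hidden associativity commutation relation at `x, y, z, w`:
`6 [Ŷ(x;y), Ŷ(z;w)] = Ŷ([x,y,z]; w) + Ŷ(z; [x,y,w])`, with the commutator of operators
on the left. -/
def HiddenAssocAt (br : Γ →ₗ[K] Γ →ₗ[K] Γ) (x y z w : Γ) : Prop :=
  (6 : K) • ⁅yamagutian br x y, yamagutian br z w⁆ =
    yamagutian br (yamagutiBracket br x y z) w + yamagutian br z (yamagutiBracket br x y w)

/-- Hidden associativity: the commutation relation holds identically. -/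
def HiddenAssociativity (br : Γ →ₗ[K] Γ →ₗ[K] Γ) : Prop :=
  ∀ x y z w : Γ, HiddenAssocAt br x y z w

/-- The ternary identity
`[x,y,[z,w,v]] = [[x,y,z],w,v] + [z,[x,y,w],v] + [z,w,[x,y,v]]` at `x, y, z, w, v`. -/
def TernaryIdentityAt (t : Γ → Γ → Γ → Γ) (x y z w v : Γ) : Prop :=
  t x y (t z w v) = t (t x y z) w v + t z (t x y w) v + t z w (t x y v)

/-- The axioms (a)-(e) of a general Lie triple system with binary bracket `b` and
ternary bracket `t`. -/
structure GLTSAxiomsAtoE (b : Γ → Γ → Γ) (t : Γ → Γ → Γ → Γ) : Prop where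
  law_a : ∀ x y, b x y = -b y x
  law_b : ∀ x y z, t x y z = -t y x z
  law_c : ∀ x y z, t x y z + t y z x + t z x y + b (b x y) z + b (b y z) x + b (b z x) y = 0
  law_d : ∀ x y z u, t (b x y) z u + t (b y z) x u + t (b z x) y u = 0
  law_e : ∀ x y z u, t x y (b z u) = b (t x y z) u + b z (t x y u)

/-- The axioms (a)-(f) of a general Lie triple system. -/
structure IsGeneralLieTripleSystem (b : Γ → Γ → Γ) (t : Γ → Γ → Γ → Γ) : Prop
    extends GLTSAxiomsAtoE b t where
  law_f : ∀ x y z w v, TernaryIdentityAt t x y z w v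

end Algebra

/-! ### Local analytic Moufang loops and their tangent algebras -/

section Loop

variable (E : Type*) [NormedAddCommGroup E] [NormedSpace ℝ E]

/-- A local (real) analytic Moufang loop, written in coordinates centred at the unit:
germs at the origin of an analytic multiplication with unit `0`, analytic left division `x \ y`
and analytic right division `y / x`, subject to the Moufang identity `(xy)(zx) = (x(yz))x`. -/
structure LocalAnalyticMoufangLoop where
  mul : E → E → E
  ldiv : E → E → E
  rdiv : E → E → E
  analyticAt_mul : AnalyticAt ℝ (fun p : E × E => mul p.1 p.2) (0, 0)
  analyticAt_ldiv : AnalyticAt ℝ (fun p : E × E => ldiv p.1 p.2) (0, 0)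
  analyticAt_rdiv : AnalyticAt ℝ (fun p : E × E => rdiv p.1 p.2) (0, 0)
  mul_unit : ∀ᶠ x in 𝓝 (0 : E), mul x 0 = x
  unit_mul : ∀ᶠ x in 𝓝 (0 : E), mul 0 x = x
  mul_ldiv : ∀ᶠ p in 𝓝 ((0, 0) : E × E), mul p.1 (ldiv p.1 p.2) = p.2
  ldiv_mul : ∀ᶠ p in 𝓝 ((0, 0) : E × E), ldiv p.1 (mul p.1 p.2) = p.2
  rdiv_mul : ∀ᶠ p in 𝓝 ((0, 0) : E × E), mul (rdiv p.2 p.1) p.1 = p.2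
  mul_rdiv : ∀ᶠ p in 𝓝 ((0, 0) : E × E), rdiv (mul p.2 p.1) p.1 = p.2
  moufang : ∀ᶠ p in 𝓝 ((0, 0, 0) : E × E × E),
    mul (mul p.1 p.2.1) (mul p.2.2 p.1) = mul (mul p.1 (mul p.2.1 p.2.2)) p.1

variable {E}

namespace LocalAnalyticMoufangLoop

/-- The bilinear part `B` of the multiplication, `xy = x + y + B(x,y) + …`, where `…` stands for
terms of order at least three and for terms of order two in `x` alone or in `y` alone
(which vanish because `0` is the unit). -/
def bilinearPart (G : LocalAnalyticMoufangLoop E) : E →L[ℝ] E →L[ℝ] E :=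
  fderiv ℝ (fun u : E => fderiv ℝ (fun v : E => G.mul u v) 0) 0

/-- The bracket `[x,y] = B(x,y) - B(y,x)` of the tangent algebra of `G`; its underlying space
is the tangent space `E` at the unit. -/
def tangentBracket (G : LocalAnalyticMoufangLoop E) : E →ₗ[ℝ] E →ₗ[ℝ] E :=
  LinearMap.mk₂ ℝ (fun x y => G.bilinearPart x y - G.bilinearPart y x)
    (fun x x' y => by simp only [map_add, add_apply]; abel)
    (fun c x y => by simp only [map_smul, smul_apply, smul_sub])
    (fun x y y' => by simp only [map_add, add_apply]; abel)
    (fun c x y => by simp only [map_smul, smul_apply, smul_sub])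

end LocalAnalyticMoufangLoop

end Loop

end

section HiddenAssociativity

variable {K Γ : Type*} [Field K] [AddCommGroup Γ] [Module K Γ]

/-! Put T = [x,y,·] and S = [z,w,·]. The Yamagutians are T/6 and S/6, so six times their commutator
is (TS - ST)/6, and the right side of the commutation relation carries the same single factor 1/6.
Evaluating at v, cancelling 1/6 and moving S(Tv) across gives the ternary identity. The argument is
formal in the bracket, so tangent algebras are an instance. -/

theorem yamagutian_apply (br : Γ →ₗ[K] Γ →ₗ[K] Γ) (x y z : Γ) :
    yamagutian br x y z = (6 : K)⁻¹ • yamagutiBracket br x y z :=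
  rfl

theorem yamagutiBracket_smul_right (br : Γ →ₗ[K] Γ →ₗ[K] Γ) (c : K) (x y z : Γ) :
    yamagutiBracket br x y (c • z) = c • yamagutiBracket br x y z := by
  simp only [yamagutiBracket, map_smul, smul_sub, smul_add]

/-- Evaluated at `v`, six times the commutator of two Yamagutians. -/
theorem six_smul_lie_yamagutian_apply (h6 : (6 : K) ≠ 0) (br : Γ →ₗ[K] Γ →ₗ[K] Γ)
    (x y z w v : Γ) :
    ((6 : K) • ⁅yamagutian br x y, yamagutian br z w⁆) v =
      (6 : K)⁻¹ • (yamagutiBracket br x y (yamagutiBracket br z w v) -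
        yamagutiBracket br z w (yamagutiBracket br x y v)) := by
  -- The factor `6` absorbs the outer Yamagutian's `6⁻¹`; the inner `6⁻¹` comes out by homogeneity
  -- in the third slot.
  rw [LinearMap.smul_apply, Ring.lie_def, LinearMap.sub_apply, Module.End.mul_apply,
    Module.End.mul_apply, smul_sub, six_smul_yamagutian h6, six_smul_yamagutian h6,
    yamagutian_apply, yamagutian_apply, yamagutiBracket_smul_right, yamagutiBracket_smul_right,
    smul_sub]

theorem hiddenAssocAt_iff (h6 : (6 : K) ≠ 0) (br : Γ →ₗ[K] Γ →ₗ[K] Γ) (x y z w : Γ) :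
    HiddenAssocAt br x y z w ↔
      ∀ v : Γ, TernaryIdentityAt (yamagutiBracket br) x y z w v := by
  rw [HiddenAssocAt, LinearMap.ext_iff]
  refine forall_congr' fun v => ?_
  -- Each rewrite is an equivalence, since scaling by `6⁻¹` is injective; both directions come at
  -- once.
  rw [six_smul_lie_yamagutian_apply h6, LinearMap.add_apply, yamagutian_apply, yamagutian_apply,
    ← smul_add, (smul_right_injective Γ (inv_ne_zero h6)).eq_iff, sub_eq_iff_eq_add,
    TernaryIdentityAt]

theorem hiddenAssociativity_iff (h6 : (6 : K) ≠ 0) (br : Γ →ₗ[K] Γ →ₗ[K] Γ) :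
    HiddenAssociativity br ↔
      ∀ x y z w v : Γ, TernaryIdentityAt (yamagutiBracket br) x y z w v := by
  simp only [HiddenAssociativity, hiddenAssocAt_iff h6]

theorem isGeneralLieTripleSystem_iff (h6 : (6 : K) ≠ 0) (br : Γ →ₗ[K] Γ →ₗ[K] Γ) :
    IsGeneralLieTripleSystem (fun x y => br x y) (yamagutiBracket br) ↔
      GLTSAxiomsAtoE (fun x y => br x y) (yamagutiBracket br) ∧ HiddenAssociativity br := by
  rw [hiddenAssociativity_iff h6]
  -- After the rewrite, hidden associativity has become `law_f` itself.
  exact ⟨fun h => ⟨h.toGLTSAxiomsAtoE, h.law_f⟩, fun h => ⟨h.1, h.2⟩⟩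

end HiddenAssociativity

theorem mainTheorem3 :
    (∀ {K : Type*} {Γ : Type*} [Field K] [AddCommGroup Γ] [Module K Γ],
      (6 : K) ≠ 0 → ∀ br : Γ →ₗ[K] Γ →ₗ[K] Γ,
        (∀ x y z w : Γ, HiddenAssocAt br x y z w ↔
          ∀ v : Γ, TernaryIdentityAt (yamagutiBracket br) x y z w v) ∧
        (HiddenAssociativity br ↔
          ∀ x y z w v : Γ, TernaryIdentityAt (yamagutiBracket br) x y z w v) ∧
        (IsGeneralLieTripleSystem (fun x y => br x y) (yamagutiBracket br) ↔
          GLTSAxiomsAtoE (fun x y => br x y) (yamagutiBracket br) ∧ HiddenAssociativity br)) ∧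
    (∀ {E : Type*} [NormedAddCommGroup E] [NormedSpace ℝ E] [FiniteDimensional ℝ E]
      (G : LocalAnalyticMoufangLoop E),
        (∀ x y z w : E, HiddenAssocAt G.tangentBracket x y z w ↔
          ∀ v : E, TernaryIdentityAt (yamagutiBracket G.tangentBracket) x y z w v) ∧
        (HiddenAssociativity G.tangentBracket ↔
          ∀ x y z w v : E,
            TernaryIdentityAt (yamagutiBracket G.tangentBracket) x y z w v)) := by
  refine ⟨fun h6 br => ⟨hiddenAssocAt_iff h6 br, hiddenAssociativity_iff h6 br,
    isGeneralLieTripleSystem_iff h6 br⟩, fun G => ?_⟩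
  have h6 : (6 : ℝ) ≠ 0 := by norm_num
  exact ⟨hiddenAssocAt_iff h6 G.tangentBracket, hiddenAssociativity_iff h6 G.tangentBracket⟩
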